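/- Let $k$ be a field, $S=k[x_1,x_2,x_3]$, and let $\Lambda\subset\mathbb Z^3$ be a subgroup of rank $2$ (codimension $1$) that is an antichain for the componentwise order. For $v\in\mathbb Z^3$ put $v^+=v\vee 0$, $v^-=(-v)\vee 0$, and let $I_\Lambda=\langle X^{v^+}-X^{v^-} : v\in\Lambda\rangle\subset S$. A Markov basis of $\Lambda$ is a finite set $B\subset\Lambda$ such that for every $u\in\mathbb N^3$ the graph on the fiber $(u+\Lambda)\cap\mathbb N^3$, in which distinct $v,w$ are joined when $v-w\in B$ or $w-v\in B$, is connected; it is minimal if it is minimal under inclusion. Assume that $\Lambda$ is generic, i.e. it has a minimal Markov basis all of whose elements have all three coordinates nonzero. Then: (a) Every minimal Markov basis of $\Lambda$ is, up to the signs of its elements, of the form $\{\lambda_1,\lambda_2,\lambda_3\}$ with $$\lambda_1=(\alpha_1,-\beta_1,-\gamma_1),\quad \lambda_2=(-\alpha_2,\beta_2,-\gamma_2),\quad \lambda_3=(-\alpha_3,-\beta_3,\gamma_3)$$ for positive integers $\alpha_i,\beta_i,\gamma_i$. (b) Whenever $\lambda_1,\lambda_2,\lambda_3$ of the form displayed in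 (a), with nonnegative integers $\alpha_i,\beta_i,\gamma_i$, form a Markov basis of $\Lambda$, one has $\lambda_1+\lambda_2+\lambda_3=0$, and $$0\leftarrow S/I_\Lambda\leftarrow S\xleftarrow{\,d_1\,}Se_{\lambda_1}\oplus Se_{\lambda_2}\oplus Se_{\lambda_3}\xleftarrow{\,d_2\,}Se_{p_1}\oplus Se_{p_2}\leftarrow 0$$ with the canonical projection $S\to S/I_\Lambda$ and $$d_1(e_{\lambda_i})=X^{\lambda_i^+}-X^{\lambda_i^-},$$ $$d_2(e_{p_1})=x_3^{\gamma_2}e_{\lambda_1}+x_1^{\alpha_3}e_{\lambda_2}+x_2^{\beta_1}e_{\lambda_3},\qquad d_2(e_{p_2})=x_2^{\beta_3}e_{\lambda_1}+x_3^{\gamma_1}e_{\lambda_2}+x_1^{\alpha_2}e_{\lambda_3}$$ is a minimal $\mathbb Z^3/\Lambda$-graded free resolution of $S/I_\Lambda$: it is exact, its maps are homogeneous of degree $0$ for suitable degrees of the basis elements, and the image of each of $d_1,d_2$ lies in $(x_1,x_2,x_3)$ times its target. -/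

import Mathlib

open MvPolynomial

namespace LatticeRes

/-- The fiber graph over `u ∈ ℕⁿ`: the vertices are the `v ∈ ℕⁿ` with `u - v ∈ Λ`, and distinct
vertices `v, w` are joined when `v - w` or `w - v` lies in `B`. -/
def fiberGraph {n : ℕ} (Λ : AddSubgroup (Fin n → ℤ)) (B : Set (Fin n → ℤ)) (u : Fin n → ℕ) :
    SimpleGraph {v : Fin n → ℕ // (fun i => (u i : ℤ) - (v i : ℤ)) ∈ Λ} where
  Adj v w := v ≠ w ∧
    ((fun i => (v.1 i : ℤ) - (w.1 i : ℤ)) ∈ B ∨ (fun i => (w.1 i : ℤ) - (v.1 i : ℤ)) ∈ B)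
  symm := ⟨fun _ _ h => ⟨h.1.symm, h.2.symm⟩⟩
  loopless := ⟨fun _ h => h.1 rfl⟩

/-- A Markov basis of `Λ`: a finite subset of `Λ` all of whose fiber graphs are connected. -/
def IsMarkovBasis {n : ℕ} (Λ : AddSubgroup (Fin n → ℤ)) (B : Set (Fin n → ℤ)) : Prop :=
  B.Finite ∧ B ⊆ (Λ : Set (Fin n → ℤ)) ∧ ∀ u : Fin n → ℕ, (fiberGraph Λ B u).Connected

/-- A Markov basis that is minimal with respect to inclusion. -/
def IsMinimalMarkovBasis {n : ℕ} (Λ : AddSubgroup (Fin n → ℤ)) (B : Set (Fin n → ℤ)) : Prop :=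
  Minimal (IsMarkovBasis Λ) B

/-- `Λ` is generic: some minimal Markov basis consists of fully supported vectors. -/
def IsGeneric {n : ℕ} (Λ : AddSubgroup (Fin n → ℤ)) : Prop :=
  ∃ L : Set (Fin n → ℤ), IsMinimalMarkovBasis Λ L ∧ ∀ v ∈ L, ∀ i, v i ≠ 0

/-- The binomial `X^{v⁺} - X^{v⁻}`, where `v⁺ = v ∨ 0` and `v⁻ = (-v) ∨ 0`. -/
noncomputable def binomial (k : Type*) [Field k] {n : ℕ} (v : Fin n → ℤ) :
    MvPolynomial (Fin n) k :=
  (∏ i, X i ^ (v i).toNat) - ∏ i, X i ^ (-v i).toNat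

/-- The lattice ideal `I_Λ`. -/
noncomputable def latticeIdeal (k : Type*) [Field k] {n : ℕ} (Λ : AddSubgroup (Fin n → ℤ)) :
    Ideal (MvPolynomial (Fin n) k) :=
  Ideal.span (binomial k '' (Λ : Set (Fin n → ℤ)))

/-- The homogeneous maximal ideal `(x₁, …, xₙ)`. -/
noncomputable def irrelevantIdeal (k : Type*) [Field k] (n : ℕ) :
    Ideal (MvPolynomial (Fin n) k) :=
  Ideal.span (Set.range X)

/-- The degree of the variable `xᵢ` in the `ℤⁿ/Λ`-grading of the polynomial ring. -/
def varDegree {n : ℕ} (Λ : AddSubgroup (Fin n → ℤ)) (i : Fin n) : (Fin n → ℤ) ⧸ Λ :=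
  QuotientAddGroup.mk (Pi.single i 1)

/-- `0 ← S/I ← S ← S^p ← S^q ← 0`, with `S = k[x₁, …, xₙ]`, is a minimal `ℤⁿ/Λ`-graded free
resolution of `S/I`: the sequence is exact, the maps are homogeneous of degree zero for suitable
degrees `a`, `c` of the basis vectors of `S^p` and `S^q` (the basis vector of `S` having degree
zero), and the image of each map lies in `(x₁, …, xₙ)` times its target. -/
structure IsMinimalFreeResolution {k : Type*} [Field k] {n p q : ℕ}
    (Λ : AddSubgroup (Fin n → ℤ)) (I : Ideal (MvPolynomial (Fin n) k))
    (d₁ : (Fin p → MvPolynomial (Fin n) k) →ₗ[MvPolynomial (Fin n) k] MvPolynomial (Fin n) k)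
    (d₂ : (Fin q → MvPolynomial (Fin n) k) →ₗ[MvPolynomial (Fin n) k]
      (Fin p → MvPolynomial (Fin n) k)) : Prop where
  exact_zero : Function.Exact d₁ (Submodule.mkQ I)
  exact_one : Function.Exact d₂ d₁
  exact_two : Function.Injective d₂
  homogeneous : ∃ (a : Fin p → (Fin n → ℤ) ⧸ Λ) (c : Fin q → (Fin n → ℤ) ⧸ Λ),
    (∀ i, IsWeightedHomogeneous (varDegree Λ) (d₁ (Pi.single i 1)) (a i)) ∧
    ∀ j i, IsWeightedHomogeneous (varDegree Λ) (d₂ (Pi.single j 1) i) (c j - a i)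
  minimal_one : LinearMap.range d₁ ≤ irrelevantIdeal k n
  minimal_two : LinearMap.range d₂ ≤
    irrelevantIdeal k n • (⊤ : Submodule (MvPolynomial (Fin n) k) (Fin p → MvPolynomial (Fin n) k))

/-- The vectors `λ₁ = (α₁, -β₁, -γ₁)`, `λ₂ = (-α₂, β₂, -γ₂)`, `λ₃ = (-α₃, -β₃, γ₃)`
(indices are shifted by one in the code). -/
def lam (α β γ : Fin 3 → ℕ) : Fin 3 → Fin 3 → ℤ :=
  ![![(α 0 : ℤ), -(β 0 : ℤ), -(γ 0 : ℤ)],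
    ![-(α 1 : ℤ), (β 1 : ℤ), -(γ 1 : ℤ)],
    ![-(α 2 : ℤ), -(β 2 : ℤ), (γ 2 : ℤ)]]

/-- The map `S e_{λ₁} ⊕ S e_{λ₂} ⊕ S e_{λ₃} → S`, `e_{λᵢ} ↦ X^{λᵢ⁺} - X^{λᵢ⁻}`. -/
noncomputable def firstMap (k : Type*) [Field k] (α β γ : Fin 3 → ℕ) :
    (Fin 3 → MvPolynomial (Fin 3) k) →ₗ[MvPolynomial (Fin 3) k] MvPolynomial (Fin 3) k :=
  Fintype.linearCombination (MvPolynomial (Fin 3) k) (fun i => binomial k (lam α β γ i))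

/-- The map `S e_{p₁} ⊕ S e_{p₂} → S e_{λ₁} ⊕ S e_{λ₂} ⊕ S e_{λ₃}` with
`e_{p₁} ↦ x₃^{γ₂} e_{λ₁} + x₁^{α₃} e_{λ₂} + x₂^{β₁} e_{λ₃}` and
`e_{p₂} ↦ x₂^{β₃} e_{λ₁} + x₃^{γ₁} e_{λ₂} + x₁^{α₂} e_{λ₃}`. -/
noncomputable def secondMap (k : Type*) [Field k] (α β γ : Fin 3 → ℕ) :
    (Fin 2 → MvPolynomial (Fin 3) k) →ₗ[MvPolynomial (Fin 3) k]
      (Fin 3 → MvPolynomial (Fin 3) k) :=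
  Fintype.linearCombination (MvPolynomial (Fin 3) k)
    ![![X 2 ^ γ 1, X 0 ^ α 2, X 1 ^ β 0],
      ![X 1 ^ β 2, X 2 ^ γ 0, X 0 ^ α 1]]

end LatticeRes

/-! Let `L` be a minimal Markov basis with full support. Points of the fiber of v⁺ (v ∈ `L`) sharing
a support index are connected without using v, so by minimality no point of that fiber meets both
supp v⁺ and supp v⁻ (`IsMinimalMarkovBasis.not_meet`). If moreover v has a single positive
coordinate, full support shrinks its fiber to {v⁺, v⁻} (`IsMinimalMarkovBasis.fiber_eq`), and every
Markov basis must contain v or -v. In ℤ³ each element of `L` has one positive coordinate up to sign,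
and rank two with the antichain condition gives exactly one such vector for each coordinate. These
are the λ_i, and (a) follows.

The i-th coordinate of λ_i is minimal among lattice vectors positive only at i. Applied to pairwise
sums of the λ_i and to their negatives, this gives ∑ λ_i ≤ 0, hence ∑ λ_i = 0
(`IsMarkovBasis.sum_lam`).

Paths in fibers telescope, so the three binomials generate the lattice ideal. By the zero sum they
are the maximal minors of the 2 × 3 matrix of d₂. Two of them are coprime (`isRelPrime_binomials`),
so Cramer's rule gives exactness, as in Hilbert–Burch (`exists_rows_of_syzygy`). -/

namespace LatticeRes

/-! ### Paths in fibers and indispensable moves -/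

section Linked

variable {n : ℕ}

/-- Two points of `ℕⁿ` are linked by `B` if a path with steps in `±B` joins them in `ℕⁿ`. -/
def Linked (B : Set (Fin n → ℤ)) : (Fin n → ℕ) → (Fin n → ℕ) → Prop :=
  Relation.ReflTransGen fun v w =>
    (fun i => (v i : ℤ) - (w i : ℤ)) ∈ B ∨ (fun i => (w i : ℤ) - (v i : ℤ)) ∈ B

theorem Linked.symm {B : Set (Fin n → ℤ)} {v w : Fin n → ℕ} (h : Linked B v w) :
    Linked B w v := by
  induction h with
  | refl => exact Relation.ReflTransGen.refl
  | tail _ hbc ih => exact Relation.ReflTransGen.head hbc.symm ih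

theorem Linked.add_right {B : Set (Fin n → ℤ)} {v w : Fin n → ℕ} (h : Linked B v w)
    (m : Fin n → ℕ) : Linked B (v + m) (w + m) := by
  refine Relation.ReflTransGen.lift (fun v => v + m) (fun a b hab => ?_) _ _ h
  simpa [Function.onFun] using hab

theorem IsMarkovBasis.linked {Λ : AddSubgroup (Fin n → ℤ)} {B : Set (Fin n → ℤ)}
    (hB : IsMarkovBasis Λ B) {v w : Fin n → ℕ} (h : (fun i => (v i : ℤ) - (w i : ℤ)) ∈ Λ) :
    Linked B v w := by
  have hv : (fun i => (v i : ℤ) - (v i : ℤ)) ∈ Λ := by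
    simp only [sub_self]
    exact Λ.zero_mem
  have := (hB.2.2 v).preconnected ⟨v, hv⟩ ⟨w, h⟩
  rw [SimpleGraph.reachable_iff_reflTransGen] at this
  exact Relation.ReflTransGen.lift Subtype.val (fun a b hab => hab.2) _ _ this

theorem isMarkovBasis_of_linked {Λ : AddSubgroup (Fin n → ℤ)} {B : Set (Fin n → ℤ)}
    (hfin : B.Finite) (hB : B ⊆ (Λ : Set (Fin n → ℤ)))
    (h : ∀ v w : Fin n → ℕ, (fun i => (v i : ℤ) - (w i : ℤ)) ∈ Λ → Linked B v w) :
    IsMarkovBasis Λ B := by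
  refine ⟨hfin, hB, fun u => ?_⟩
  have hu : (fun i => (u i : ℤ) - (u i : ℤ)) ∈ Λ := by
    simp only [sub_self]
    exact Λ.zero_mem
  have key : ∀ w : Fin n → ℕ, Linked B u w → ∃ hw : (fun i => (u i : ℤ) - (w i : ℤ)) ∈ Λ,
      (fiberGraph Λ B u).Reachable ⟨u, hu⟩ ⟨w, hw⟩ := by
    intro w hw
    induction hw with
    | refl => exact ⟨hu, SimpleGraph.Reachable.refl _⟩
    | @tail b c _ hbc ih =>
      obtain ⟨hb, hr⟩ := ih
      have hbc' : (fun i => (b i : ℤ) - (c i : ℤ)) ∈ Λ := by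
        rcases hbc with h | h
        · exact hB h
        · convert Λ.neg_mem (hB h) using 1
          ext i; simp
      have hc : (fun i => (u i : ℤ) - (c i : ℤ)) ∈ Λ := by
        convert Λ.add_mem hb hbc' using 1
        ext i; simp
      refine ⟨hc, hr.trans ?_⟩
      -- If 0 lies in `B`, a linked step may be stationary, while the graph has no loops.
      by_cases hne : b = c
      · subst hne; exact SimpleGraph.Reachable.refl _
      · exact SimpleGraph.Adj.reachable ⟨fun h => hne (congrArg Subtype.val h), hbc⟩
  have : Nonempty {v : Fin n → ℕ // (fun i => (u i : ℤ) - (v i : ℤ)) ∈ Λ} := ⟨⟨u, hu⟩⟩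
  refine SimpleGraph.Connected.mk fun a b => ?_
  obtain ⟨_, ha⟩ := key a.1 (h u a.1 a.2)
  obtain ⟨_, hb⟩ := key b.1 (h u b.1 b.2)
  exact ha.symm.trans hb

/-- The positive part `v⁺` of an integer vector. -/
def posPart (v : Fin n → ℤ) : Fin n → ℕ := fun i => (v i).toNat

/-- The fiber of `v⁺` modulo `Λ`. -/
def InFiber (Λ : AddSubgroup (Fin n → ℤ)) (v : Fin n → ℤ) (x : Fin n → ℕ) : Prop :=
  (fun i => (x i : ℤ) - (v i).toNat) ∈ Λ

theorem Linked.of_subset {B C : Set (Fin n → ℤ)} (h : ∀ v ∈ B, v ∈ C ∨ -v ∈ C)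
    {v w : Fin n → ℕ} (hl : Linked B v w) : Linked C v w := by
  have e : ∀ a b : Fin n → ℕ,
      (fun i => (b i : ℤ) - (a i : ℤ)) = -(fun i => (a i : ℤ) - (b i : ℤ)) := by
    intro a b; ext i; simp
  refine Relation.ReflTransGen.mono (fun a b hab => ?_) _ _ hl
  rcases hab with hab | hab
  · have := h _ hab
    rwa [← e] at this
  · have := h _ hab
    rw [← e] at this
    exact this.symm

theorem Linked.of_replace {B C : Set (Fin n → ℤ)}
    (h : ∀ v ∈ B, Linked C (posPart v) (posPart (-v)))
    {v w : Fin n → ℕ} (hl : Linked B v w) : Linked C v w := by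
  have key : ∀ a b : Fin n → ℕ, (fun i => (a i : ℤ) - (b i : ℤ)) ∈ B → Linked C a b := by
    intro a b hab
    -- With v = a - b, one has a = v⁺ + a ∧ b and b = v⁻ + a ∧ b.
    have := (h _ hab).add_right (fun i => min (a i) (b i))
    convert this using 1 <;> (ext i; simp only [posPart, Pi.add_apply, Pi.neg_apply]; omega)
  induction hl with
  | refl => exact Relation.ReflTransGen.refl
  | tail _ hbc ih =>
    refine Relation.ReflTransGen.trans ih ?_
    rcases hbc with hbc | hbc
    · exact key _ _ hbc
    · exact (key _ _ hbc).symm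

theorem eq_zero_of_nonneg {Λ : AddSubgroup (Fin n → ℤ)}
    (hanti : IsAntichain (· ≤ ·) (Λ : Set (Fin n → ℤ))) {v : Fin n → ℤ} (hv : v ∈ Λ)
    (h : ∀ i, 0 ≤ v i) : v = 0 :=
  (hanti.eq Λ.zero_mem hv h).symm

theorem eq_zero_of_nonpos {Λ : AddSubgroup (Fin n → ℤ)}
    (hanti : IsAntichain (· ≤ ·) (Λ : Set (Fin n → ℤ))) {v : Fin n → ℤ} (hv : v ∈ Λ)
    (h : ∀ i, v i ≤ 0) : v = 0 :=
  hanti.eq hv Λ.zero_mem h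

/-- An element of a minimal Markov basis is not redundant. -/
theorem IsMinimalMarkovBasis.not_linked {Λ : AddSubgroup (Fin n → ℤ)} {B : Set (Fin n → ℤ)}
    (hB : IsMinimalMarkovBasis Λ B) {v : Fin n → ℤ} (hv : v ∈ B) :
    ¬ Linked (B \ {v}) (posPart v) (posPart (-v)) := by
  intro hl
  have hm : IsMarkovBasis Λ (B \ {v}) := by
    refine isMarkovBasis_of_linked (hB.prop.1.subset Set.sdiff_subset)
      (Set.sdiff_subset.trans hB.prop.2.1) fun a b hab => ?_
    refine Linked.of_replace (fun w hw => ?_) (hB.prop.linked hab)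
    by_cases hwv : w = v
    · rwa [hwv]
    · refine Relation.ReflTransGen.single (Or.inl ?_)
      convert (show w ∈ B \ {v} from ⟨hw, hwv⟩) using 1
      ext i; simp [posPart]
  exact ((hB.le_of_le hm Set.sdiff_subset) hv).2 rfl

/-- Points of the fiber of `v⁺` with a common support element are linked without using `v`. -/
theorem IsMarkovBasis.linked_diff {Λ : AddSubgroup (Fin n → ℤ)} {B : Set (Fin n → ℤ)}
    (hanti : IsAntichain (· ≤ ·) (Λ : Set (Fin n → ℤ)))
    (hB : IsMarkovBasis Λ B) {v : Fin n → ℤ} {x y : Fin n → ℕ} (hx : InFiber Λ v x)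
    (hy : InFiber Λ v y) {i : Fin n} (hxi : 0 < x i) (hyi : 0 < y i) :
    Linked (B \ {v}) x y := by
  -- The path is taken between x - e and y - e and then translated back by e.
  let e : Fin n → ℕ := Pi.single i 1
  have he : ∀ z : Fin n → ℕ, 0 < z i → z - e + e = z := by
    intro z hz
    ext j
    by_cases hj : j = i
    · subst hj; simp [e]; omega
    · simp [e, hj]
  have hxy : (fun j => ((x - e) j : ℤ) - ((y - e) j : ℤ)) ∈ Λ := by
    have := Λ.sub_mem hx hy
    convert this using 1
    ext j
    have h1 := congrFun (he x hxi) j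
    have h2 := congrFun (he y hyi) j
    simp only [Pi.add_apply] at h1 h2
    simp only [Pi.sub_apply] at h1 h2 ⊢
    omega
  -- A step by v out of a forces a ≥ v⁺, so a + e would lie strictly above v⁺ in the same fiber,
  -- against the antichain condition.
  have noStep : ∀ a b : Fin n → ℕ, InFiber Λ v (a + e) →
      (fun j => (a j : ℤ) - (b j : ℤ)) ≠ v := by
    intro a b ha hab
    have h0 := eq_zero_of_nonneg hanti ha (fun j => by
      have := congrFun hab j
      simp only [Pi.add_apply]
      push_cast
      omega)
    have h1 := congrFun h0 i
    have := congrFun hab i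
    simp [e] at h1
    omega
  have key : ∀ z, Linked B (x - e) z → InFiber Λ v (z + e) ∧ Linked (B \ {v}) x (z + e) := by
    intro z hz
    induction hz with
    | refl => rw [he x hxi]; exact ⟨hx, Relation.ReflTransGen.refl⟩
    | @tail b c _ hbc ih =>
      obtain ⟨hb, hl⟩ := ih
      have hcb : (fun i => (c i : ℤ) - (b i : ℤ)) ∈ Λ := by
        rcases hbc with h | h
        · convert Λ.neg_mem (hB.2.1 h) using 1
          ext i; simp
        · exact hB.2.1 h
      have hc : InFiber Λ v (c + e) := by
        unfold InFiber
        convert Λ.add_mem hb hcb using 1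
        ext i; simp; ring
      refine ⟨hc, hl.tail ?_⟩
      have e1 : ∀ a b : Fin n → ℕ, (fun i => (((a + e) i : ℕ) : ℤ) - (((b + e) i : ℕ) : ℤ)) =
          (fun i => (a i : ℤ) - (b i : ℤ)) := by
        intro a b; ext i; simp
      rw [e1, e1]
      exact hbc.imp (fun h => ⟨h, noStep b c hb⟩) (fun h => ⟨h, noStep c b hc⟩)
  have := (key _ (hB.linked hxy)).2
  rwa [he y hyi] at this

theorem InFiber.neg {Λ : AddSubgroup (Fin n → ℤ)} {v : Fin n → ℤ} (hv : v ∈ Λ)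
    {x : Fin n → ℕ} (hx : InFiber Λ v x) : InFiber Λ (-v) x := by
  unfold InFiber
  convert Λ.add_mem hx hv using 1
  ext i; simp; omega

theorem inFiber_posPart (Λ : AddSubgroup (Fin n → ℤ)) (v : Fin n → ℤ) :
    InFiber Λ v (posPart v) := by
  simp only [InFiber, posPart, sub_self]
  exact Λ.zero_mem

/-- A point in the fiber of `v⁺` cannot meet both the support of `v⁺` and that of `v⁻`. -/
theorem IsMinimalMarkovBasis.not_meet {Λ : AddSubgroup (Fin n → ℤ)} {B : Set (Fin n → ℤ)}
    (hanti : IsAntichain (· ≤ ·) (Λ : Set (Fin n → ℤ)))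
    (hB : IsMinimalMarkovBasis Λ B) {v : Fin n → ℤ} (hv : v ∈ B ∨ -v ∈ B) {x : Fin n → ℕ}
    (hx : InFiber Λ v x) {i j : Fin n} (hxi : 0 < x i) (hvi : 0 < v i) (hxj : 0 < x j)
    (hvj : v j < 0) : False := by
  have main : ∀ w : Fin n → ℤ, w ∈ B → InFiber Λ w x → ∀ i j, 0 < x i → 0 < w i → 0 < x j →
      w j < 0 → False := by
    intro w hw hx i j hxi hwi hxj hwj
    have hwΛ := hB.prop.2.1 hw
    -- Through x, the points w⁺ and w⁻ would be linked without w.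
    refine hB.not_linked hw ((hB.prop.linked_diff hanti (inFiber_posPart Λ w) hx (i := i) ?_
      hxi).trans (hB.prop.linked_diff hanti hx (y := posPart (-w)) ?_ (i := j) hxj ?_))
    · simp [posPart, hwi]
    · have := (inFiber_posPart Λ (-w)).neg (Λ.neg_mem hwΛ)
      rwa [neg_neg] at this
    · simp [posPart, hwj]
  rcases hv with hv | hv
  · exact main v hv hx i j hxi hvi hxj hvj
  · have hvΛ : v ∈ Λ := by simpa using Λ.neg_mem (hB.prop.2.1 hv)
    exact main (-v) hv (hx.neg hvΛ) j i hxj (by simpa) hxi (by simpa)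

/-- A linked point different from `v` admits a move. -/
theorem Linked.exists_move {B : Set (Fin n → ℤ)} {v w : Fin n → ℕ} (h : Linked B v w)
    (hne : v ≠ w) : ∃ m : Fin n → ℤ, (m ∈ B ∨ -m ∈ B) ∧ ∀ i, m i ≤ v i := by
  rcases Relation.ReflTransGen.cases_head h with h | ⟨c, hc, _⟩
  · exact absurd h hne
  · refine ⟨fun i => (v i : ℤ) - c i, ?_, fun i => by simp⟩
    convert hc using 2
    ext i; simp

/-- If a fully supported element of `±B` has exactly one positive coordinate, then
its fiber has only two points. -/
theorem IsMinimalMarkovBasis.fiber_eq {Λ : AddSubgroup (Fin n → ℤ)} {B : Set (Fin n → ℤ)}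
    (hanti : IsAntichain (· ≤ ·) (Λ : Set (Fin n → ℤ)))
    (hB : IsMinimalMarkovBasis Λ B) (hfull : ∀ v ∈ B, ∀ i, v i ≠ 0)
    {v : Fin n → ℤ} (hv : v ∈ B ∨ -v ∈ B) {i : Fin n} (hi : 0 < v i)
    (hneg : ∀ j, j ≠ i → v j < 0) {x : Fin n → ℕ} (hx : InFiber Λ v x) :
    x = posPart v ∨ x = posPart (-v) := by
  have hvΛ : v ∈ Λ := hv.elim (fun h => hB.prop.2.1 h)
    (fun h => by simpa using Λ.neg_mem (hB.prop.2.1 h))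
  by_cases hxi : 0 < x i
  · left
    have hxj : ∀ j, j ≠ i → x j = 0 := by
      intro j hj
      by_contra h
      exact hB.not_meet hanti hv hx hxi hi (Nat.pos_of_ne_zero h) (hneg j hj)
    -- Both x and v⁺ are concentrated at i, hence comparable.
    have hz : (fun j => (x j : ℤ) - (v j).toNat) = 0 := by
      rcases le_total (x i : ℤ) (v i) with h | h
      · refine eq_zero_of_nonpos hanti hx fun j => ?_
        by_cases hj : j = i
        · subst hj; omega
        · have := hxj j hj
          omega
      · refine eq_zero_of_nonneg hanti hx fun j => ?_
        by_cases hj : j = i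
        · subst hj; omega
        · have := hneg j hj
          omega
    ext j
    have := congrFun hz j
    simp only [posPart, Pi.zero_apply] at this ⊢
    omega
  · right
    by_contra hne
    -- Since δ vanishes at i, a move m out of δ⁺ has m_i < 0 by full support. At an index j with δ_j
    -- > 0, x_j exceeds δ_j because v_j < 0. So x - m is positive at both i and j, which `not_meet`
    -- forbids.
    let δ : Fin n → ℤ := fun j => (x j : ℤ) - (-v j).toNat
    have hδ : δ ∈ Λ := hx.neg hvΛ
    have hδi : δ i = 0 := by simp only [δ]; omega
    have hpos : ∃ j, 0 < δ j := by
      by_contra! h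
      have h0 := eq_zero_of_nonpos hanti hδ h
      apply hne
      ext j
      have := congrFun h0 j
      simp only [posPart, Pi.zero_apply, Pi.neg_apply, δ] at this ⊢
      omega
    obtain ⟨j, hj⟩ := hpos
    have hji : j ≠ i := by rintro rfl; omega
    have hl : Linked B (posPart δ) (posPart (-δ)) := by
      apply hB.prop.linked
      convert hδ using 1
      ext l; simp [posPart]
    obtain ⟨m, hm, hmle⟩ := hl.exists_move (fun h => by
      have := congrFun h j
      simp only [posPart, Pi.neg_apply] at this
      omega)
    have hmi : m i ≠ 0 := hm.elim (fun h => hfull m h i) (fun h => by simpa using hfull _ h i)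
    have hmΛ : m ∈ Λ := hm.elim (fun h => hB.prop.2.1 h)
      (fun h => by simpa using Λ.neg_mem (hB.prop.2.1 h))
    have hle : ∀ l, m l + 0 ≤ (x l : ℤ) ∧ (l = j → m l < x l) := by
      intro l
      have h1 := hmle l
      have h2 := hneg j hji
      simp only [posPart, δ] at h1
      refine ⟨by omega, ?_⟩
      rintro rfl
      simp only [δ] at hj
      omega
    have hmi' := hmle i
    simp only [posPart, hδi] at hmi'
    refine hB.not_meet hanti hv (x := fun l => ((x l : ℤ) - m l).toNat) ?_ (i := i) (j := j)
      ?_ hi ?_ (hneg j hji)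
    · unfold InFiber
      convert Λ.sub_mem hx hmΛ using 1
      ext l
      have := (hle l).1
      simp only [Pi.sub_apply]
      omega
    · simp at hmi'; omega
    · have := (hle j).2 rfl
      change 0 < ((x j : ℤ) - m j).toNat
      omega

/-- A two-point fiber forces `v` or `-v` into every Markov basis. -/
theorem IsMarkovBasis.mem_or_neg_mem {Λ : AddSubgroup (Fin n → ℤ)} {B : Set (Fin n → ℤ)}
    (hB : IsMarkovBasis Λ B) {v : Fin n → ℤ} (hv : v ∈ Λ) (hne : v ≠ 0)
    (hfib : ∀ x, InFiber Λ v x → x = posPart v ∨ x = posPart (-v)) : v ∈ B ∨ -v ∈ B := by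
  have e : (fun i => (posPart v i : ℤ) - (posPart (-v) i : ℤ)) = v := by
    ext i; simp [posPart]
  have hmem : (fun i => (posPart v i : ℤ) - (posPart (-v) i : ℤ)) ∈ Λ := by rwa [e]
  by_contra! hcon
  have key : ∀ x, Linked B (posPart v) x → x = posPart v := by
    intro x hx
    induction hx with
    | refl => rfl
    | @tail b c _ hbc ih =>
      subst ih
      have hc : InFiber Λ v c := by
        rcases hbc with h | h
        · unfold InFiber
          convert Λ.neg_mem (hB.2.1 h) using 1
          ext i; simp [posPart]
        · exact hB.2.1 h
      refine (hfib c hc).resolve_right ?_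
      rintro rfl
      rcases hbc with h | h
      · rw [e] at h; exact hcon.1 h
      · apply hcon.2
        convert h using 1
        ext i; simp [posPart]; omega
  have := key _ (hB.linked hmem)
  rw [this] at e
  exact hne (by rw [← e]; ext i; simp)

end Linked

/-! ### Generic rank two lattices in ℤ³ -/

theorem eq_iff_of_fin_three {v w : Fin 3 → ℤ} :
    v = w ↔ v 0 = w 0 ∧ v 1 = w 1 ∧ v 2 = w 2 := by
  simp [funext_iff, Fin.forall_fin_succ]

/-- Otherwise evaluation at `j` would embed `Λ` in ℤ. -/
theorem exists_ne_zero_apply_eq_zero {n : ℕ} {Λ : AddSubgroup (Fin n → ℤ)}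
    (hrank : 1 < Module.finrank ℤ Λ) (j : Fin n) : ∃ v ∈ Λ, v ≠ 0 ∧ v j = 0 := by
  by_contra! hcon
  let f : Λ →ₗ[ℤ] ℤ := ((Pi.evalAddMonoidHom (fun _ : Fin n => ℤ) j).comp Λ.subtype).toIntLinearMap
  have hf : Function.Injective f := by
    rw [injective_iff_map_eq_zero]
    intro v hv
    by_contra hne
    exact hcon v.1 v.2 (fun h => hne (Subtype.ext h)) hv
  have := LinearMap.finrank_le_finrank_of_injective hf
  rw [Module.finrank_self] at this
  omega

/-- In rank two every coordinate is the positive one of some lattice vector. -/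
theorem exists_pos_of_rank_two {Λ : AddSubgroup (Fin 3 → ℤ)}
    (hanti : IsAntichain (· ≤ ·) (Λ : Set (Fin 3 → ℤ)))
    (hrank : Module.finrank ℤ Λ = 2) (i : Fin 3) :
    ∃ v ∈ Λ, 0 < v i ∧ ∀ j, j ≠ i → v j ≤ 0 := by
  -- By the antichain condition the other two coordinates have opposite signs, so v or -v works.
  -- Indices are modulo 3.
  obtain ⟨v, hv, hne, h0⟩ := exists_ne_zero_apply_eq_zero (Λ := Λ) (by omega) (i + 1)
  have hcases : ∀ w : Fin 3 → ℤ, w ∈ Λ → w ≠ 0 → w (i + 1) = 0 → w (i + 2) ≤ 0 →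
      0 < w i ∧ ∀ j, j ≠ i → w j ≤ 0 := by
    intro w hw hwne hw0 hw2
    have hj : ∀ j, j ≠ i → w j ≤ 0 := by
      intro j hj
      have : j = i + 1 ∨ j = i + 2 := (by decide : ∀ i j : Fin 3, j ≠ i → j = i + 1 ∨ j = i + 2) i j hj
      rcases this with rfl | rfl <;> omega
    refine ⟨?_, hj⟩
    by_contra h
    refine hwne (eq_zero_of_nonpos hanti hw fun j => ?_)
    by_cases hji : j = i
    · subst hji; omega
    · exact hj j hji
  rcases le_total (v (i + 2)) 0 with h | h
  · exact ⟨v, hv, hcases v hv hne h0 h⟩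
  · exact ⟨-v, Λ.neg_mem hv, hcases (-v) (Λ.neg_mem hv) (by simpa) (by simpa) (by simpa)⟩

/-- Moves out of a multiple of the `i`-th unit vector have the `i`-th coordinate positive only. -/
theorem IsMarkovBasis.exists_move_le {n : ℕ} {Λ : AddSubgroup (Fin n → ℤ)} {B : Set (Fin n → ℤ)}
    (hanti : IsAntichain (· ≤ ·) (Λ : Set (Fin n → ℤ)))
    (hB : IsMarkovBasis Λ B) (hfull : ∀ v ∈ B, ∀ i, v i ≠ 0) {v : Fin n → ℤ} (hv : v ∈ Λ)
    {i : Fin n} (hi : 0 < v i) (hneg : ∀ j, j ≠ i → v j ≤ 0) :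
    ∃ m : Fin n → ℤ, (m ∈ B ∨ -m ∈ B) ∧ (0 < m i ∧ ∀ j, j ≠ i → m j < 0) ∧ m i ≤ v i := by
  have hl : Linked B (posPart v) (posPart (-v)) := by
    apply hB.linked
    convert hv using 1
    ext l; simp [posPart]
  obtain ⟨m, hm, hle⟩ := hl.exists_move (fun h => by
      have := congrFun h i
      simp only [posPart, Pi.neg_apply] at this
      omega)
  have hmne : ∀ j, m j ≠ 0 := fun j =>
    hm.elim (fun h => hfull m h j) (fun h => by simpa using hfull _ h j)
  have hmΛ : m ∈ Λ := hm.elim (fun h => hB.2.1 h)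
      (fun h => by simpa using Λ.neg_mem (hB.2.1 h))
  have hj : ∀ j, j ≠ i → m j < 0 := by
    intro j hj
    have h1 := hle j
    have h2 := hneg j hj
    have h3 := hmne j
    simp only [posPart] at h1
    omega
  refine ⟨m, hm, ⟨?_, hj⟩, ?_⟩
  · by_contra h
    refine hmne i (congrFun (eq_zero_of_nonpos hanti hmΛ fun j => ?_) i)
    by_cases hji : j = i
    · subst hji; omega
    · exact (hj j hji).le
  · have := hle i
    simp only [posPart] at this
    omega

/-- For each coordinate there is at most one element of `±B` positive exactly there. -/
theorem IsMinimalMarkovBasis.eq_of_pos {n : ℕ} {Λ : AddSubgroup (Fin n → ℤ)}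
    {B : Set (Fin n → ℤ)} (hanti : IsAntichain (· ≤ ·) (Λ : Set (Fin n → ℤ)))
    (hB : IsMinimalMarkovBasis Λ B) (hfull : ∀ v ∈ B, ∀ i, v i ≠ 0)
    {v w : Fin n → ℤ} (hv : v ∈ B ∨ -v ∈ B) (hw : w ∈ B ∨ -w ∈ B) {i : Fin n}
    (hvi : 0 < v i ∧ ∀ j, j ≠ i → v j < 0) (hwi : 0 < w i ∧ ∀ j, j ≠ i → w j < 0) : v = w := by
  wlog hle : v i ≤ w i generalizing v w
  · exact (this hw hv hwi hvi (by omega)).symm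
  have hvΛ : v ∈ Λ := hv.elim (fun h => hB.prop.2.1 h)
    (fun h => by simpa using Λ.neg_mem (hB.prop.2.1 h))
  have e : ∀ j, (((posPart w j : ℤ) - v j).toNat : ℤ) = posPart w j - v j := by
    intro j
    apply Int.toNat_of_nonneg
    by_cases hj : j = i
    · subst hj; simp only [posPart]; omega
    · have := hvi.2 j hj; omega
  -- Subtracting v from w⁺ stays in the two-point fiber of w⁺ and changes the point, so it reaches
  -- w⁻; hence v = w.
  have hx : InFiber Λ w (fun j => ((posPart w j : ℤ) - v j).toNat) := by
    unfold InFiber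
    convert Λ.neg_mem hvΛ using 1
    ext j
    rw [e]
    simp [posPart]
  rcases hB.fiber_eq hanti hfull hw hwi.1 hwi.2 hx with h | h
  · have h1 := congrFun h i
    have h2 := e i
    simp only [h1] at h2
    omega
  · ext j
    have h1 := congrFun h j
    have h2 := e j
    simp only [h1] at h2
    simp only [posPart, Pi.neg_apply] at h2
    omega

/-- The structure of a generic rank two lattice in `ℤ³`. -/
theorem IsGeneric.exists_lam {Λ : AddSubgroup (Fin 3 → ℤ)}
    (hanti : IsAntichain (· ≤ ·) (Λ : Set (Fin 3 → ℤ)))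
    (hrank : Module.finrank ℤ Λ = 2) (hgen : IsGeneric Λ) :
    ∃ α β γ : Fin 3 → ℕ, (∀ i, 0 < α i ∧ 0 < β i ∧ 0 < γ i) ∧
      IsMarkovBasis Λ (Set.range (lam α β γ)) ∧
      ∀ i x, InFiber Λ (lam α β γ i) x →
        x = posPart (lam α β γ i) ∨ x = posPart (-lam α β γ i) := by
  obtain ⟨L, hL, hfull⟩ := hgen
  have hex : ∀ i, ∃ m : Fin 3 → ℤ, (m ∈ L ∨ -m ∈ L) ∧ (0 < m i ∧ ∀ j, j ≠ i → m j < 0) := by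
    intro i
    obtain ⟨v, hv, hi, hj⟩ := exists_pos_of_rank_two hanti hrank i
    obtain ⟨m, h1, h2, _⟩ := hL.prop.exists_move_le hanti hfull hv hi hj
    exact ⟨m, h1, h2⟩
  choose m hm hpos using hex
  have hmΛ : ∀ i, m i ∈ Λ := fun i => (hm i).elim (fun h => hL.prop.2.1 h)
    (fun h => by simpa using Λ.neg_mem (hL.prop.2.1 h))
  have hlam : lam (fun i => (m i 0).natAbs) (fun i => (m i 1).natAbs)
      (fun i => (m i 2).natAbs) = m := by
    have := (hpos 0).1; have := (hpos 0).2 1 (by decide); have := (hpos 0).2 2 (by decide)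
    have := (hpos 1).1; have := (hpos 1).2 0 (by decide); have := (hpos 1).2 2 (by decide)
    have := (hpos 2).1; have := (hpos 2).2 0 (by decide); have := (hpos 2).2 1 (by decide)
    ext i j
    fin_cases i <;> fin_cases j <;> simp [lam, -Nat.cast_natAbs] <;> omega
  have hne : ∀ i j, m i j ≠ 0 := by
    intro i j
    by_cases hj : j = i
    · subst hj; exact (hpos j).1.ne'
    · exact ((hpos i).2 j hj).ne
  refine ⟨fun i => (m i 0).natAbs, fun i => (m i 1).natAbs, fun i => (m i 2).natAbs,
    fun i => ?_, ?_, ?_⟩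
  rotate_left
  · exact hlam.symm ▸ isMarkovBasis_of_linked (Set.finite_range m)
      (by rintro _ ⟨i, rfl⟩; exact hmΛ i) fun v w hvw =>
        (hL.prop.linked hvw).of_subset fun u hu => by
          have huΛ := hL.prop.2.1 hu
          -- Dimension three enters here: three nonzero entries of mixed sign split as one against
          -- two.
          have hcase : ∃ i, (0 < u i ∧ ∀ j, j ≠ i → u j < 0) ∨
              (0 < (-u) i ∧ ∀ j, j ≠ i → (-u) j < 0) := by
            by_contra hno
            simp only [Fin.exists_fin_succ, Fin.forall_fin_succ, Pi.neg_apply] at hno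
            have h0 := hfull u hu 0
            have h1 := hfull u hu 1
            have h2 := hfull u hu 2
            have hp : ¬ ∀ j, 0 ≤ u j := fun h =>
              h0 (congrFun (eq_zero_of_nonneg hanti huΛ h) 0)
            have hn : ¬ ∀ j, u j ≤ 0 := fun h =>
              h0 (congrFun (eq_zero_of_nonpos hanti huΛ h) 0)
            simp [Fin.forall_fin_succ] at hp hn hno
            omega
          obtain ⟨i, h | h⟩ := hcase
          · left
            exact ⟨i, (hL.eq_of_pos hanti hfull (Or.inl hu) (hm i) h (hpos i)).symm⟩
          · right
            exact ⟨i, (hL.eq_of_pos hanti hfull (Or.inr (by simpa using hu)) (hm i) h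
              (hpos i)).symm⟩
  · rw [hlam]
    exact fun i x hx => hL.fiber_eq hanti hfull (hm i) (hpos i).1 (hpos i).2 hx
  · exact ⟨Int.natAbs_pos.2 (hne i 0), Int.natAbs_pos.2 (hne i 1), Int.natAbs_pos.2 (hne i 2)⟩

/-- The sign pattern determines the index. The negated case is impossible because a negated vector
has two positive entries, while `lam α' β' γ' j` has at most one. -/
theorem lam_injective {α β γ : Fin 3 → ℕ} (hpos : ∀ i, 0 < α i ∧ 0 < β i ∧ 0 < γ i)
    {α' β' γ' : Fin 3 → ℕ} {i j : Fin 3}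
    (h : lam α β γ i = lam α' β' γ' j ∨ -lam α β γ i = lam α' β' γ' j) :
    α i = α' i ∧ β i = β' i ∧ γ i = γ' i := by
  have h0 := hpos i
  simp only [eq_iff_of_fin_three] at h
  fin_cases i <;> fin_cases j <;> simp [lam] at h0 h ⊢ <;> omega

/-- Nonnegative vectors of the prescribed sign pattern forming a Markov basis are the ones
forced by genericity. -/
theorem lam_eq_of_mem_range {α β γ α' β' γ' : Fin 3 → ℕ}
    (hpos : ∀ i, 0 < α i ∧ 0 < β i ∧ 0 < γ i)
    (h : ∀ i, lam α β γ i ∈ Set.range (lam α' β' γ') ∨ -lam α β γ i ∈ Set.range (lam α' β' γ')) :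
    α = α' ∧ β = β' ∧ γ = γ' := by
  have : ∀ i, α i = α' i ∧ β i = β' i ∧ γ i = γ' i := by
    intro i
    rcases h i with ⟨j, hj⟩ | ⟨j, hj⟩
    · exact lam_injective hpos (Or.inl hj.symm)
    · exact lam_injective hpos (Or.inr hj.symm)
  exact ⟨funext fun i => (this i).1, funext fun i => (this i).2.1, funext fun i => (this i).2.2⟩

theorem lam_ne_zero {α β γ : Fin 3 → ℕ} (hpos : ∀ i, 0 < α i ∧ 0 < β i ∧ 0 < γ i)
    (i j : Fin 3) : lam α β γ i j ≠ 0 := by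
  have := hpos i
  fin_cases i <;> fin_cases j <;> simp [lam] at this ⊢ <;> omega

theorem IsMarkovBasis.sum_lam {Λ : AddSubgroup (Fin 3 → ℤ)}
    (hanti : IsAntichain (· ≤ ·) (Λ : Set (Fin 3 → ℤ)))
    {α β γ : Fin 3 → ℕ} (hpos : ∀ i, 0 < α i ∧ 0 < β i ∧ 0 < γ i)
    (hB : IsMarkovBasis Λ (Set.range (lam α β γ))) :
    lam α β γ 0 + lam α β γ 1 + lam α β γ 2 = 0 := by
  have hΛ : ∀ i, lam α β γ i ∈ Λ := fun i => hB.2.1 ⟨i, rfl⟩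
  have hfull : ∀ v ∈ Set.range (lam α β γ), ∀ i, v i ≠ 0 := by
    rintro _ ⟨i, rfl⟩ j
    exact lam_ne_zero hpos i j
  have p0 := hpos 0
  have p1 := hpos 1
  have p2 := hpos 2
  -- The first move on a path from v⁺ to v⁻ can only be λ_i.
  have hmin : ∀ v ∈ Λ, ∀ i, 0 < v i → (∀ j, j ≠ i → v j ≤ 0) → lam α β γ i i ≤ v i := by
    intro v hv i hi hj
    obtain ⟨m, hm, ⟨h1, h2⟩, hle⟩ := hB.exists_move_le hanti hfull hv hi hj
    have hex : ∃ l, lam α β γ l = m ∨ lam α β γ l = -m :=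
      hm.elim (fun ⟨l, hl⟩ => ⟨l, Or.inl hl⟩) (fun ⟨l, hl⟩ => ⟨l, Or.inr hl⟩)
    obtain ⟨l, hl⟩ := hex
    simp only [eq_iff_of_fin_three] at hl
    refine le_trans ?_ hle
    clear hle hm hi hj
    have q0 := h2 0
    have q1 := h2 1
    have q2 := h2 2
    clear h2
    fin_cases i <;> fin_cases l <;> simp [lam] at h1 q0 q1 q2 hl ⊢ <;> omega
  have hcases : ∀ v ∈ Λ, (0 < v 0 → v 1 ≤ 0 → v 2 ≤ 0 → (α 0 : ℤ) ≤ v 0) ∧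
      (v 0 ≤ 0 → 0 < v 1 → v 2 ≤ 0 → (β 1 : ℤ) ≤ v 1) ∧
      (v 0 ≤ 0 → v 1 ≤ 0 → 0 < v 2 → (γ 2 : ℤ) ≤ v 2) ∧
      (v 0 ≤ 0 → v 1 ≤ 0 → v 2 ≤ 0 → v 0 = 0 ∧ v 1 = 0 ∧ v 2 = 0) := by
    intro v hv
    refine ⟨fun h0 h1 h2 => ?_, fun h0 h1 h2 => ?_, fun h0 h1 h2 => ?_, fun h0 h1 h2 => ?_⟩
    · simpa [lam] using hmin v hv 0 h0 (by simp [Fin.forall_fin_succ, h1, h2])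
    · simpa [lam] using hmin v hv 1 h1 (by simp [Fin.forall_fin_succ, h0, h2])
    · simpa [lam] using hmin v hv 2 h2 (by simp [Fin.forall_fin_succ, h0, h1])
    · have := eq_zero_of_nonpos hanti hv (by simp [Fin.forall_fin_succ, h0, h1, h2])
      simp [this]
  -- Each pairwise sum is negative in the remaining coordinate. Exactly one positive coordinate
  -- would contradict minimality (for instance α₀ ≤ α₀ - α₁), and none would contradict the
  -- antichain condition. So the other two are positive, and the negated sum gives bounds such as γ₂
  -- ≤ γ₀ + γ₁. Together these make the total sum nonpositive, hence zero.
  have c01 := hcases _ (Λ.add_mem (hΛ 0) (hΛ 1))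
  have c02 := hcases _ (Λ.add_mem (hΛ 0) (hΛ 2))
  have c12 := hcases _ (Λ.add_mem (hΛ 1) (hΛ 2))
  have n01 := (hcases _ (Λ.neg_mem (Λ.add_mem (hΛ 0) (hΛ 1)))).2.2.1
  have n02 := (hcases _ (Λ.neg_mem (Λ.add_mem (hΛ 0) (hΛ 2)))).2.1
  have n12 := (hcases _ (Λ.neg_mem (Λ.add_mem (hΛ 1) (hΛ 2)))).1
  have hs := (hcases _ (Λ.add_mem (Λ.add_mem (hΛ 0) (hΛ 1)) (hΛ 2))).2.2.2
  have e : lam α β γ = ![![(α 0 : ℤ), -(β 0 : ℤ), -(γ 0 : ℤ)],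
    ![-(α 1 : ℤ), (β 1 : ℤ), -(γ 1 : ℤ)], ![-(α 2 : ℤ), -(β 2 : ℤ), (γ 2 : ℤ)]] := rfl
  simp only [e, Pi.add_apply, Pi.neg_apply, Matrix.cons_val] at c01 c02 c12 n01 n02 n12 hs
  clear hmin hcases hfull hΛ
  ext j
  fin_cases j <;> simp [e] <;> omega

/-! ### From paths to generators of the lattice ideal -/

section Ideal

variable (k : Type*) [Field k] {n : ℕ}

/-- A linked pair gives a difference of monomials in the ideal of the moves. -/
theorem Linked.sub_mem_span {B : Set (Fin n → ℤ)} {v w : Fin n → ℕ} (h : Linked B v w) :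
    ((∏ i, X i ^ v i) - ∏ i, X i ^ w i : MvPolynomial (Fin n) k) ∈
      Ideal.span (binomial k '' B) := by
  have key : ∀ a b : Fin n → ℕ, (fun i => (a i : ℤ) - (b i : ℤ)) ∈ B →
      ((∏ i, X i ^ a i) - ∏ i, X i ^ b i : MvPolynomial (Fin n) k) ∈
        Ideal.span (binomial k '' B) := by
    intro a b hab
    -- The factor is the gcd of the two monomials.
    have h1 := Ideal.mul_mem_left _ (∏ i, X i ^ min (a i) (b i))
      (Ideal.subset_span (Set.mem_image_of_mem (binomial k) hab))
    convert h1 using 1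
    rw [binomial, mul_sub, ← Finset.prod_mul_distrib, ← Finset.prod_mul_distrib]
    congr 1 <;> refine Finset.prod_congr rfl fun i _ => ?_ <;> rw [← pow_add] <;> congr 1 <;> omega
  induction h with
  | refl => simp
  | tail _ hbc ih =>
    rw [← sub_add_sub_cancel]
    refine Ideal.add_mem _ ih ?_
    rcases hbc with h | h
    · exact key _ _ h
    · rw [← neg_sub]
      exact neg_mem (key _ _ h)

/-- The binomials of a Markov basis generate the lattice ideal. -/
theorem IsMarkovBasis.span_binomial {Λ : AddSubgroup (Fin n → ℤ)} {B : Set (Fin n → ℤ)}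
    (hB : IsMarkovBasis Λ B) : Ideal.span (binomial k '' B) = latticeIdeal k Λ := by
  refine le_antisymm (Ideal.span_mono (Set.image_mono hB.2.1)) (Ideal.span_le.2 ?_)
  rintro _ ⟨v, hv, rfl⟩
  refine (hB.linked (v := posPart v) (w := posPart (-v)) ?_).sub_mem_span k
  convert (show v ∈ Λ from hv) using 1
  ext i; simp [posPart]

end Ideal

/-! ### Syzygies of minors and coprimality of the binomials -/

/-- The syzygies of the maximal minors of a `2 × 3` matrix, two of which form a regular
sequence, are spanned by the rows. -/
theorem exists_rows_of_syzygy {R : Type*} [CommRing R] [IsDomain R] {a b c d e f u v w : R}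
    (hne : a * e - b * d ≠ 0)
    (hreg : ∀ g, a * e - b * d ∣ (c * d - a * f) * g → a * e - b * d ∣ g)
    (h : u * (b * f - c * e) + v * (c * d - a * f) + w * (a * e - b * d) = 0) :
    ∃ p q, u = p * a + q * d ∧ v = p * b + q * e ∧ w = p * c + q * f := by
  -- Here p and q are the Cramer quotients with denominator ae - bd; the syzygy makes the numerators
  -- divisible after multiplication by cd - af.
  obtain ⟨p, hp⟩ := hreg (u * e - v * d) ⟨w * d - u * f, by linear_combination (-d) * h⟩
  obtain ⟨q, hq⟩ := hreg (v * a - u * b) ⟨u * c - a * w, by linear_combination a * h⟩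
  refine ⟨p, q, mul_left_cancel₀ hne ?_, mul_left_cancel₀ hne ?_, mul_left_cancel₀ hne ?_⟩
  · linear_combination a * hp + d * hq
  · linear_combination b * hp + e * hq
  · linear_combination c * hp + f * hq + h

section RelPrime

variable {k : Type*} [Field k]

theorem degreeOf_eq_zero_of_dvd {σ : Type*} {p q : MvPolynomial σ k} (h : p ∣ q) (hq : q ≠ 0)
    {j : σ} (hj : degreeOf j q = 0) : degreeOf j p = 0 := by
  obtain ⟨r, rfl⟩ := h
  rw [degreeOf_mul_eq (left_ne_zero_of_mul hq) (right_ne_zero_of_mul hq)] at hj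
  omega

theorem isUnit_of_degreeOf_eq_zero {σ : Type*} {p : MvPolynomial σ k} (hp : p ≠ 0)
    (h : ∀ j, degreeOf j p = 0) : IsUnit p := by
  have h0 : p.totalDegree = 0 := by
    rw [totalDegree_eq_zero_iff]
    intro m hm x
    have := monomial_le_degreeOf x hm
    rw [h x] at this
    omega
  rw [totalDegree_eq_zero_iff_eq_C] at h0
  rw [h0] at hp ⊢
  exact (IsUnit.mk0 _ (fun h => hp (by rw [h, C_0]))).map C

theorem degreeOf_monomials_sub_eq_zero {i l j : Fin 3} (hi : i ≠ j) (hl : l ≠ j) (r s t u : ℕ) :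
    degreeOf j (X i ^ r * X l ^ s - X i ^ t * X l ^ u : MvPolynomial (Fin 3) k) = 0 := by
  have hX : ∀ (i : Fin 3) (m : ℕ), i ≠ j →
      degreeOf j (X i ^ m : MvPolynomial (Fin 3) k) = 0 := by
    intro i m h
    have := degreeOf_pow_le j (X i : MvPolynomial (Fin 3) k) m
    rw [degreeOf_X_of_ne h.symm] at this
    omega
  have hm : ∀ r s, degreeOf j (X i ^ r * X l ^ s : MvPolynomial (Fin 3) k) = 0 := by
    intro r s
    have := degreeOf_mul_le j (X i ^ r : MvPolynomial (Fin 3) k) (X l ^ s)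
    rw [hX i r hi, hX l s hl] at this
    omega
  have := degreeOf_sub_le j (X i ^ r * X l ^ s : MvPolynomial (Fin 3) k) (X i ^ t * X l ^ u)
  rw [hm, hm] at this
  omega

/-- Two of the three binomials have no common factor. -/
theorem isRelPrime_binomials {a b c a' b' c' : ℕ} (ha : 0 < a) (hb : 0 < b)
    (ha' : 0 < a') (hc : 0 < c) (hc' : 0 < c') :
    IsRelPrime (X 2 ^ c' - X 0 ^ a' * X 1 ^ b' : MvPolynomial (Fin 3) k)
      (X 1 ^ b - X 0 ^ a * X 2 ^ c) := by
  intro d hd' hd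
  -- Raising the two congruences modulo d to suitable powers eliminates each variable in turn: `e0`,
  -- `e1`, `e2` give multiples of d free of `X 0`, `X 1`, `X 2`. As degrees add in a domain, d is
  -- constant.
  have hpow : ∀ m, d ∣ X 1 ^ (b * m) - X 0 ^ (a * m) * X 2 ^ (c * m) := by
    intro m
    have := hd.trans (sub_dvd_pow_sub_pow _ _ m)
    rwa [mul_pow, ← pow_mul, ← pow_mul, ← pow_mul] at this
  have hpow' : ∀ m, d ∣ X 2 ^ (c' * m) - X 0 ^ (a' * m) * X 1 ^ (b' * m) := by
    intro m
    have := hd'.trans (sub_dvd_pow_sub_pow _ _ m)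
    rwa [mul_pow, ← pow_mul, ← pow_mul, ← pow_mul] at this
  have e0 : d ∣ X 1 ^ (b * a' + b' * a) * X 2 ^ 0 - X 1 ^ 0 * X 2 ^ (c * a' + c' * a) := by
    convert dvd_sub ((hpow a').mul_left (X 1 ^ (b' * a))) ((hpow' a).mul_left (X 2 ^ (c * a')))
      using 1
    ring
  have e1 : d ∣ X 0 ^ 0 * X 2 ^ (c' * b) - X 0 ^ (a' * b + a * b') * X 2 ^ (c * b') := by
    convert dvd_add (hpow' b) ((hpow b').mul_left (X 0 ^ (a' * b))) using 1
    ring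
  have e2 : d ∣ X 0 ^ 0 * X 1 ^ (b * c') - X 0 ^ (a * c' + a' * c) * X 1 ^ (b' * c) := by
    convert dvd_add (hpow c') ((hpow' c).mul_left (X 0 ^ (a * c'))) using 1
    ring
  have key : ∀ (g : MvPolynomial (Fin 3) k) (x : Fin 3 → k), eval x g ≠ 0 → g ≠ 0 := by
    rintro g x h rfl
    exact h (map_zero _)
  -- At each chosen point one monomial is 1 and the other vanishes.
  have n0 := key (X 1 ^ (b * a' + b' * a) * X 2 ^ 0 - X 1 ^ 0 * X 2 ^ (c * a' + c' * a))
    ![0, 1, 0] (by simp [hc.ne', ha'.ne'])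
  have n1 := key (X 0 ^ 0 * X 2 ^ (c' * b) - X 0 ^ (a' * b + a * b') * X 2 ^ (c * b'))
    ![0, 0, 1] (by simp [hb.ne', ha'.ne'])
  have n2 := key (X 0 ^ 0 * X 1 ^ (b * c') - X 0 ^ (a * c' + a' * c) * X 1 ^ (b' * c))
    ![0, 1, 0] (by simp [hc'.ne', ha.ne'])
  refine isUnit_of_degreeOf_eq_zero (ne_zero_of_dvd_ne_zero n0 e0) fun j => ?_
  fin_cases j
  · exact degreeOf_eq_zero_of_dvd e0 n0
      (degreeOf_monomials_sub_eq_zero (by decide) (by decide) _ _ _ _)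
  · exact degreeOf_eq_zero_of_dvd e1 n1
      (degreeOf_monomials_sub_eq_zero (by decide) (by decide) _ _ _ _)
  · exact degreeOf_eq_zero_of_dvd e2 n2
      (degreeOf_monomials_sub_eq_zero (by decide) (by decide) _ _ _ _)

end RelPrime

/-! ### Exactness, minimality and grading of the complex -/

section Resolution

variable (k : Type*) [Field k] {α β γ : Fin 3 → ℕ}

theorem binomial_lam (α β γ : Fin 3 → ℕ) :
    (fun i => binomial k (lam α β γ i)) = ![X 0 ^ α 0 - X 1 ^ β 0 * X 2 ^ γ 0,
      X 1 ^ β 1 - X 0 ^ α 1 * X 2 ^ γ 1, X 2 ^ γ 2 - X 0 ^ α 2 * X 1 ^ β 2] := by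
  ext1 i
  fin_cases i <;> simp [binomial, lam, Fin.prod_univ_three]

theorem firstMap_apply (α β γ : Fin 3 → ℕ) (h : Fin 3 → MvPolynomial (Fin 3) k) :
    firstMap k α β γ h = h 0 * (X 0 ^ α 0 - X 1 ^ β 0 * X 2 ^ γ 0) +
      h 1 * (X 1 ^ β 1 - X 0 ^ α 1 * X 2 ^ γ 1) +
      h 2 * (X 2 ^ γ 2 - X 0 ^ α 2 * X 1 ^ β 2) := by
  rw [firstMap, binomial_lam]
  simp [Fintype.linearCombination_apply, Fin.sum_univ_three]

theorem secondMap_apply (α β γ : Fin 3 → ℕ) (h : Fin 2 → MvPolynomial (Fin 3) k) :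
    secondMap k α β γ h = ![h 0 * X 2 ^ γ 1 + h 1 * X 1 ^ β 2,
      h 0 * X 0 ^ α 2 + h 1 * X 2 ^ γ 0, h 0 * X 1 ^ β 0 + h 1 * X 0 ^ α 1] := by
  ext1 i
  fin_cases i <;> simp [secondMap, Fintype.linearCombination_apply, Fin.sum_univ_two]

theorem range_firstMap (α β γ : Fin 3 → ℕ) :
    LinearMap.range (firstMap k α β γ) =
      Ideal.span (binomial k '' Set.range (lam α β γ)) := by
  rw [firstMap, Fintype.range_linearCombination, ← Set.range_comp]
  rfl

theorem exact_firstMap {Λ : AddSubgroup (Fin 3 → ℤ)}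
    (hB : IsMarkovBasis Λ (Set.range (lam α β γ))) :
    Function.Exact (firstMap k α β γ) (Submodule.mkQ (latticeIdeal k Λ)) := by
  rw [LinearMap.exact_iff, Submodule.ker_mkQ, range_firstMap, hB.span_binomial k]

theorem minor_ne_zero (hpos : ∀ i, 0 < α i ∧ 0 < β i ∧ 0 < γ i) :
    (X 2 ^ γ 2 - X 0 ^ α 2 * X 1 ^ β 2 : MvPolynomial (Fin 3) k) ≠ 0 := by
  intro h
  have := congrArg (eval ![0, 0, 1]) h
  simp [(hpos 2).1.ne'] at this

theorem exact_secondMap (hpos : ∀ i, 0 < α i ∧ 0 < β i ∧ 0 < γ i)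
    (hα : α 0 = α 1 + α 2) (hβ : β 1 = β 0 + β 2) (hγ : γ 2 = γ 0 + γ 1) :
    Function.Exact (secondMap k α β γ) (firstMap k α β γ) := by
  intro h
  constructor
  · intro hh
    rw [firstMap_apply] at hh
    have hne := minor_ne_zero k hpos
    have hrel := isRelPrime_binomials (k := k) (b' := β 2) (hpos 1).1 (hpos 1).2.1 (hpos 2).1
      (hpos 1).2.2 (hpos 2).2.2
    -- The zero sum of the λ_i splits the pure powers, which exhibits the binomials as the minors of
    -- the matrix of `secondMap`.
    have e3 : (X 2 ^ γ 2 - X 0 ^ α 2 * X 1 ^ β 2 : MvPolynomial (Fin 3) k) =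
        X 2 ^ γ 1 * X 2 ^ γ 0 - X 0 ^ α 2 * X 1 ^ β 2 := by rw [hγ]; ring
    have e2 : (X 1 ^ β 1 - X 0 ^ α 1 * X 2 ^ γ 1 : MvPolynomial (Fin 3) k) =
        X 1 ^ β 0 * X 1 ^ β 2 - X 2 ^ γ 1 * X 0 ^ α 1 := by rw [hβ]; ring
    have e1 : (X 0 ^ α 0 - X 1 ^ β 0 * X 2 ^ γ 0 : MvPolynomial (Fin 3) k) =
        X 0 ^ α 2 * X 0 ^ α 1 - X 1 ^ β 0 * X 2 ^ γ 0 := by rw [hα]; ring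
    rw [e2, e3] at hrel
    rw [e3] at hne
    rw [e1, e2, e3] at hh
    obtain ⟨p, q, h0, h1, h2⟩ := exists_rows_of_syzygy hne
      (fun g hg => hrel.dvd_of_dvd_mul_left hg) hh
    refine ⟨![p, q], ?_⟩
    rw [secondMap_apply]
    ext1 i
    fin_cases i
    · exact h0.symm
    · exact h1.symm
    · exact h2.symm
  · rintro ⟨g, rfl⟩
    rw [firstMap_apply, secondMap_apply]
    simp only [Matrix.cons_val]
    rw [hα, hβ, hγ]
    ring

/-- Cramer's rule on the first two components: their determinant is the nonzero third binomial. -/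
theorem secondMap_injective (hpos : ∀ i, 0 < α i ∧ 0 < β i ∧ 0 < γ i) (hγ : γ 2 = γ 0 + γ 1) :
    Function.Injective (secondMap k α β γ) := by
  rw [injective_iff_map_eq_zero]
  intro g hg
  rw [secondMap_apply] at hg
  have h0 : g 0 * X 2 ^ γ 1 + g 1 * X 1 ^ β 2 = 0 := congrFun hg 0
  have h1 : g 0 * X 0 ^ α 2 + g 1 * X 2 ^ γ 0 = 0 := congrFun hg 1
  have hne := minor_ne_zero k hpos
  rw [hγ] at hne
  ext1 i
  fin_cases i
  · refine (mul_eq_zero.1 (?_ : _ * g 0 = 0)).resolve_left hne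
    linear_combination X 2 ^ γ 0 * h0 - X 1 ^ β 2 * h1
  · refine (mul_eq_zero.1 (?_ : _ * g 1 = 0)).resolve_left hne
    linear_combination X 2 ^ γ 1 * h1 - X 0 ^ α 2 * h0

theorem X_pow_mem_irrelevantIdeal {n : ℕ} (i : Fin n) {m : ℕ} (hm : 0 < m) :
    (X i ^ m : MvPolynomial (Fin n) k) ∈ irrelevantIdeal k n :=
  Ideal.pow_mem_of_mem _ (Ideal.subset_span (Set.mem_range_self i)) m hm

theorem range_firstMap_le (hpos : ∀ i, 0 < α i ∧ 0 < β i ∧ 0 < γ i) :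
    LinearMap.range (firstMap k α β γ) ≤ irrelevantIdeal k 3 := by
  rintro _ ⟨h, rfl⟩
  rw [firstMap_apply]
  have hX := @X_pow_mem_irrelevantIdeal k _ 3
  refine add_mem (add_mem ?_ ?_) ?_ <;> refine Ideal.mul_mem_left _ _ (sub_mem ?_ ?_)
  · exact hX _ (hpos _).1
  · exact Ideal.mul_mem_left _ _ (hX _ (hpos _).2.2)
  · exact hX _ (hpos _).2.1
  · exact Ideal.mul_mem_left _ _ (hX _ (hpos _).2.2)
  · exact hX _ (hpos _).2.2
  · exact Ideal.mul_mem_left _ _ (hX _ (hpos _).2.1)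

theorem mem_ideal_smul_top {R ι : Type*} [CommRing R] [Finite ι] {I : Ideal R} {v : ι → R}
    (h : ∀ i, v i ∈ I) : v ∈ I • (⊤ : Submodule R (ι → R)) := by
  classical
  cases nonempty_fintype ι
  rw [pi_eq_sum_univ v]
  exact sum_mem fun i _ => Submodule.smul_mem_smul (h i) trivial

theorem range_secondMap_le (hpos : ∀ i, 0 < α i ∧ 0 < β i ∧ 0 < γ i) :
    LinearMap.range (secondMap k α β γ) ≤
      irrelevantIdeal k 3 • (⊤ : Submodule (MvPolynomial (Fin 3) k) _) := by
  rintro _ ⟨h, rfl⟩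
  rw [secondMap_apply]
  have hX := @X_pow_mem_irrelevantIdeal k _ 3
  refine mem_ideal_smul_top fun i => ?_
  fin_cases i
  · exact add_mem (Ideal.mul_mem_left _ _ (hX _ (hpos _).2.2))
      (Ideal.mul_mem_left _ _ (hX _ (hpos _).2.1))
  · exact add_mem (Ideal.mul_mem_left _ _ (hX _ (hpos _).1))
      (Ideal.mul_mem_left _ _ (hX _ (hpos _).2.2))
  · exact add_mem (Ideal.mul_mem_left _ _ (hX _ (hpos _).2.1))
      (Ideal.mul_mem_left _ _ (hX _ (hpos _).1))

theorem isWeightedHomogeneous_X_pow {n : ℕ} (Λ : AddSubgroup (Fin n → ℤ)) (i : Fin n) (m : ℕ) :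
    IsWeightedHomogeneous (varDegree Λ) (X i ^ m : MvPolynomial (Fin n) k)
      (QuotientAddGroup.mk (Pi.single i (m : ℤ))) := by
  convert (isWeightedHomogeneous_X k (varDegree Λ) i).pow m using 1
  rw [varDegree, ← QuotientAddGroup.mk_nsmul, ← Pi.single_smul]
  simp

theorem isWeightedHomogeneous_prod_X_pow {n : ℕ} (Λ : AddSubgroup (Fin n → ℤ)) (v : Fin n → ℕ) :
    IsWeightedHomogeneous (varDegree Λ) (∏ i, X i ^ v i : MvPolynomial (Fin n) k)
      (QuotientAddGroup.mk fun i => (v i : ℤ)) := by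
  convert IsWeightedHomogeneous.prod Finset.univ _ _
    (fun i _ => isWeightedHomogeneous_X_pow k Λ i (v i)) using 1
  rw [← QuotientAddGroup.mk_sum, Finset.univ_sum_single]

theorem isWeightedHomogeneous_binomial {n : ℕ} {Λ : AddSubgroup (Fin n → ℤ)} {v : Fin n → ℤ}
    (hv : v ∈ Λ) : IsWeightedHomogeneous (varDegree Λ) (binomial k v)
      (QuotientAddGroup.mk fun i => ((v i).toNat : ℤ)) := by
  have e : (QuotientAddGroup.mk fun i => ((v i).toNat : ℤ) : (Fin n → ℤ) ⧸ Λ) =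
      QuotientAddGroup.mk fun i => ((-v i).toNat : ℤ) := by
    rw [QuotientAddGroup.eq]
    convert Λ.neg_mem hv using 1
    ext i
    simp only [Pi.add_apply, Pi.neg_apply]
    omega
  refine (isWeightedHomogeneous_prod_X_pow k Λ fun i => (v i).toNat).sub ?_
  rw [e]
  exact isWeightedHomogeneous_prod_X_pow k Λ _

theorem homogeneous_maps {Λ : AddSubgroup (Fin 3 → ℤ)} (hΛ : ∀ i, lam α β γ i ∈ Λ)
    (hα : α 0 = α 1 + α 2) (hβ : β 1 = β 0 + β 2) (hγ : γ 2 = γ 0 + γ 1) :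
    ∃ (a : Fin 3 → (Fin 3 → ℤ) ⧸ Λ) (c : Fin 2 → (Fin 3 → ℤ) ⧸ Λ),
      (∀ i, IsWeightedHomogeneous (varDegree Λ) (firstMap k α β γ (Pi.single i 1)) (a i)) ∧
      ∀ j i, IsWeightedHomogeneous (varDegree Λ) (secondMap k α β γ (Pi.single j 1) i)
        (c j - a i) := by
  have hX := isWeightedHomogeneous_X_pow k Λ
  have key : ∀ (i : Fin 3) (m : ℕ) (u v : Fin 3 → ℤ), u - v - Pi.single i (m : ℤ) ∈ Λ →
      IsWeightedHomogeneous (varDegree Λ) (X i ^ m : MvPolynomial (Fin 3) k)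
        ((QuotientAddGroup.mk u : (Fin 3 → ℤ) ⧸ Λ) - QuotientAddGroup.mk v) := by
    intro i m u v h
    convert hX i m using 1
    rw [← QuotientAddGroup.mk_sub, eq_comm, QuotientAddGroup.eq]
    rwa [neg_add_eq_sub]
  refine ⟨fun i => QuotientAddGroup.mk (fun j => ((lam α β γ i j).toNat : ℤ)),
    -- Each degree is read off the first component of the syzygy, as its monomial times x₁^{α 0};
    -- the other components agree modulo `lam α β γ 0`, `-lam α β γ 1` or `-lam α β γ 2`.
    ![QuotientAddGroup.mk ![(α 0 : ℤ), 0, γ 1], QuotientAddGroup.mk ![(α 0 : ℤ), β 2, 0]],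
    fun i => ?_, fun j i => ?_⟩
  · rw [firstMap, Fintype.linearCombination_apply_single, one_smul]
    exact isWeightedHomogeneous_binomial k (hΛ i)
  · have hz := Λ.zero_mem
    have h0 := hΛ 0
    have h1 := Λ.neg_mem (hΛ 1)
    have h2 := Λ.neg_mem (hΛ 2)
    rw [secondMap, Fintype.linearCombination_apply_single, one_smul]
    fin_cases j <;> fin_cases i <;> refine key _ _ _ _ ?_
    · convert hz using 1
      rw [eq_iff_of_fin_three]
      simp only [Pi.sub_apply]; simp [lam]
    · convert h1 using 1
      rw [eq_iff_of_fin_three]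
      simp only [Pi.sub_apply, Pi.neg_apply]; simp [lam]; omega
    · convert h0 using 1
      rw [eq_iff_of_fin_three]
      simp only [Pi.sub_apply]; simp [lam]; omega
    · convert hz using 1
      rw [eq_iff_of_fin_three]
      simp only [Pi.sub_apply]; simp [lam]
    · convert h0 using 1
      rw [eq_iff_of_fin_three]
      simp only [Pi.sub_apply]; simp [lam]; omega
    · convert h2 using 1
      rw [eq_iff_of_fin_three]
      simp only [Pi.sub_apply, Pi.neg_apply]; simp [lam]; omega

end Resolution

end LatticeRes

/-! ### Assembly -/

theorem mainTheorem8 (k : Type*) [Field k] (Λ : AddSubgroup (Fin 3 → ℤ))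
    (hanti : IsAntichain (· ≤ ·) (Λ : Set (Fin 3 → ℤ)))
    (hcodim : Module.finrank ℤ Λ = 2)
    (hgen : LatticeRes.IsGeneric Λ) :
    (∀ B : Set (Fin 3 → ℤ), LatticeRes.IsMinimalMarkovBasis Λ B →
      ∃ α β γ : Fin 3 → ℕ, (∀ i, 0 < α i ∧ 0 < β i ∧ 0 < γ i) ∧
        ∃ ε : Fin 3 → ℤˣ, B = Set.range (fun i => (ε i : ℤ) • LatticeRes.lam α β γ i)) ∧
    ∀ α β γ : Fin 3 → ℕ,
      LatticeRes.IsMarkovBasis Λ (Set.range (LatticeRes.lam α β γ)) →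
        LatticeRes.lam α β γ 0 + LatticeRes.lam α β γ 1 + LatticeRes.lam α β γ 2 = 0 ∧
        LatticeRes.IsMinimalFreeResolution Λ (LatticeRes.latticeIdeal k Λ)
          (LatticeRes.firstMap k α β γ) (LatticeRes.secondMap k α β γ) := by
  open LatticeRes in
  obtain ⟨α, β, γ, hpos, hM, hfib⟩ := hgen.exists_lam hanti hcodim
  have hmem : ∀ B, IsMarkovBasis Λ B → ∀ i, lam α β γ i ∈ B ∨ -lam α β γ i ∈ B :=
    fun B hB i => hB.mem_or_neg_mem (hM.2.1 ⟨i, rfl⟩)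
      (fun h => lam_ne_zero hpos i 0 (congrFun h 0)) (hfib i)
  refine ⟨fun B hB => ⟨α, β, γ, hpos, ?_⟩, fun α' β' γ' hM' => ?_⟩
  · have hε : ∀ i, ∃ ε : ℤˣ, (ε : ℤ) • lam α β γ i ∈ B := fun i =>
      (hmem B hB.prop i).elim (fun h => ⟨1, by simpa⟩) (fun h => ⟨-1, by simpa⟩)
    choose ε hε using hε
    have hsub : Set.range (fun i => (ε i : ℤ) • lam α β γ i) ⊆ B := by
      rintro _ ⟨i, rfl⟩
      exact hε i
    -- The signed λ_i inside `B` already form a Markov basis, so minimality leaves nothing else.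
    refine ⟨ε, Set.Subset.antisymm (hB.le_of_le ?_ hsub) hsub⟩
    refine isMarkovBasis_of_linked (Set.finite_range _) (hsub.trans hB.prop.2.1)
      fun v w hvw => (hM.linked hvw).of_subset ?_
    rintro _ ⟨i, rfl⟩
    rcases Int.units_eq_one_or (ε i) with h | h
    · exact Or.inl ⟨i, by simp [h]⟩
    · exact Or.inr ⟨i, by simp [h]⟩
  -- Indispensability identifies the given vectors with the λ_i, which makes their entries positive.
  · obtain ⟨rfl, rfl, rfl⟩ := lam_eq_of_mem_range hpos (hmem _ hM')
    have hsum := hM'.sum_lam hanti hpos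
    have hs := eq_iff_of_fin_three.1 hsum
    simp [lam] at hs
    have hα : α 0 = α 1 + α 2 := by omega
    have hβ : β 1 = β 0 + β 2 := by omega
    have hγ : γ 2 = γ 0 + γ 1 := by omega
    exact ⟨hsum, exact_firstMap k hM', exact_secondMap k hpos hα hβ hγ,
      secondMap_injective k hpos hγ, homogeneous_maps k (fun i => hM'.2.1 ⟨i, rfl⟩) hα hβ hγ,
      range_firstMap_le k hpos, range_secondMap_le k hpos⟩
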